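/- Let $n\ge 1$, $K\ge 1$ and $\phi>2n$. Processors $p_0,\dots,p_{n-1}$ form a ring; each $p_i$ writes two safe registers $R_a,R_b$ with values in $\{0,\dots,K-1\}$, which $p_i$ and its successor $p_{i+1 \bmod n}$ read. A register is \emph{safe} if a read that is not concurrent with a write to it returns its most recently written (or initial) value; a read concurrent with a write may return any value of the domain. Low-level reads and writes have an invocation and a later response, and steps of different processors are interleaved arbitrarily. Each $p_i$ repeats forever: 1. read own $R_a$ into $x$; 2. $y\leftarrow \mathrm{ARead}(\phi)$; 3. if $y\ne\perp$, $i\neq 0$ and $x\ne y$, then $x\leftarrow y$; else if $y\neq\perp$, $i=0$ and $y=x$, then $x\leftarrow (x+1)\bmod K$; 4. $\mathrm{AWrite}(x)$. $\mathrm{AWrite}(\mathit{val})$ reads the processor's own $R_a$ and then $R_b$; if both reads return $\mathit{val}$ it returns, and otherwise it writes $\mathit{val}$ to $R_a$, then writes $\mathit{val}$ to $R_b$, and returns. $\mathrm{ARead}(\phi)$ reads the predecessor's $R_a$ and then $R_b$, $\phi$ times in succession; it returns the common value if all $2\phi$ reads agree, and $\perp$ otherwise. An execution starts from arbitrary values of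 all local variables and registers (the two registers of a processor may differ) and from an arbitrary position of each processor in its program, except that no low-level register operation and no $\mathrm{AWrite}$ invocation is already in progress. Only procedure invocations made during the execution are considered below. Then, in every execution, every invocation of $\mathrm{ARead}(\phi)$ made in it is \emph{quasi-atomic}. That is, for every processor $p_i$ with predecessor $p_j$, $j=i-1 \bmod n$, there are a value $x_0$, equal to the initial content of $R_a$ or of $R_b$ of $p_j$, and an assignment, to each completed $\mathrm{ARead}(\phi)$ invocation of $p_i$ with response $v\neq\perp$, of a source that is either the initial value $x_0=v$ or an invocation $\mathrm{AWrite}(v)$ of $p_j$, such that * the source, if it is an $\mathrm{AWrite}$, is invoked before the $\mathrm{ARead}$ ends; * no $\mathrm{AWrite}$ of $p_j$ later than the source is completed before the $\mathrm{ARead}$ begins; * there is no new-old inversion: if one such $\mathrm{ARead}$ ends before another begins, then the source of the first is not later than the source of the second (the initial value being earlier than every $\mathrm{AWrite}$). Moreover, an $\mathrm{ARead}(\phi)$ of $p_i$ returns $\perp$ only if it is concurrent with some $\mathrm{AWrite}$ of $p_j$, or if the two registers of $p_j$ differ initially and no $\mathrm{AWrite}$ of $p_j$ has been completed before the $\mathrm{ARead}$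 begins. -/

import Mathlib

namespace TwoRegRing

/-- The two safe registers `R_a`, `R_b` that each processor writes. -/
inductive Side where
  | a
  | b
  deriving DecidableEq

/-- Control locations of a processor. The locations `readX`, `callARead`, `guards`, `callAWrite`
belong to the main loop, `scan`, `evalScan` to the procedure `ARead(φ)`, and `check`, `test`,
`store`, `retAWrite` to the procedure `AWrite`. -/
inductive PC (φ : ℕ) where
  /-- read own output register `R_a` into `x` -/
  | readX
  /-- about to invoke `ARead(φ)` -/
  | callARead
  /-- in scan number `j` of `ARead(φ)`: read `R_a` (resp. `R_b`) of the predecessor -/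
  | scan (j : Fin φ) (r : Side)
  /-- evaluate the scans, assign the response of `ARead(φ)` to `y`, and leave `ARead(φ)` -/
  | evalScan
  /-- the two conditional statements that update `x` (with the critical section) -/
  | guards
  /-- about to invoke `AWrite(x)` -/
  | callAWrite
  /-- `AWrite` reads own `R_a` into `A` (resp. own `R_b` into `B`) -/
  | check (r : Side)
  /-- `AWrite` tests whether `A = B = val` -/
  | test
  /-- `AWrite` writes `val` to `R_a` (resp. `R_b`) -/
  | store (r : Side)
  /-- `AWrite` returns -/
  | retAWrite

/-- Control is inside an invocation of `ARead(φ)`. -/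
def PC.InARead {φ : ℕ} : PC φ → Prop
  | .scan _ _ => True
  | .evalScan => True
  | _ => False

/-- Control is inside an invocation of `AWrite`. -/
def PC.InAWrite {φ : ℕ} : PC φ → Prop
  | .check _ => True
  | .test => True
  | .store _ => True
  | .retAWrite => True
  | _ => False

/-- The current statement is a low-level read or write of a register. -/
def PC.IsRegisterOp {φ : ℕ} : PC φ → Prop
  | .readX => True
  | .scan _ _ => True
  | .check _ => True
  | .store _ => True
  | _ => False

/-- Local state of a processor. Values are in `Fin K`; in `y`, `none` stands for `⊥`.
`busy` tells that the low-level register operation of the current statement has been invoked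
and has not yet responded. -/
structure Local (φ K : ℕ) where
  pc : PC φ
  busy : Bool
  x : Fin K
  y : Option (Fin K)
  /-- argument of `AWrite` -/
  val : Fin K
  /-- local variables of `AWrite` -/
  A : Fin K
  B : Fin K
  /-- local arrays of `ARead(φ)` -/
  scanA : Fin φ → Fin K
  scanB : Fin φ → Fin K

/-- Global state: local states, and contents of the output registers of every processor.
The content changes when a write responds. -/
structure Config (n φ K : ℕ) where
  loc : Fin n → Local φ K
  reg : Fin n → Side → Fin K

/-- The response of `ARead(φ)`: the unanimous value of all `2φ` low-level reads, or `⊥`. -/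
def scanResult {φ K : ℕ} (SA SB : Fin φ → Fin K) : Option (Fin K) :=
  if h : 0 < φ then
    if ∀ j, SA j = SA ⟨0, h⟩ ∧ SB j = SA ⟨0, h⟩ then some (SA ⟨0, h⟩) else none
  else none

/-- Lines `if y ≠ ⊥ ∧ i ≠ 0 ∧ x ≠ y then x := y
else if y ≠ ⊥ ∧ i = 0 ∧ y = x then x := (x + 1) mod K` (addition in `Fin K` is modulo `K`). -/
def newX {n K : ℕ} [NeZero n] [NeZero K] (i : Fin n) (x : Fin K) : Option (Fin K) → Fin K
  | none => x
  | some y => if i ≠ 0 ∧ x ≠ y then y else if i = 0 ∧ y = x then x + 1 else x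

/-- Effect of a statement of processor `i` that accesses no register. -/
def Local.compute {n φ K : ℕ} [NeZero n] [NeZero K] (i : Fin n) (l : Local φ K) : Local φ K :=
  match l.pc with
  | .callARead => { l with pc := if h : 0 < φ then .scan ⟨0, h⟩ .a else .evalScan }
  | .evalScan => { l with y := scanResult l.scanA l.scanB, pc := .guards }
  | .guards => { l with x := newX i l.x l.y, pc := .callAWrite }
  | .callAWrite => { l with val := l.x, pc := .check .a }
  | .test => { l with pc := if l.A = l.val ∧ l.B = l.val then .retAWrite else .store .a }
  | .retAWrite => { l with pc := .readX }
  | _ => l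

/-- Effect of the response `v` of the low-level read in progress. -/
def Local.receive {φ K : ℕ} (l : Local φ K) (v : Fin K) : Local φ K :=
  match l.pc with
  | .readX => { l with busy := false, x := v, pc := .callARead }
  | .scan j .a => { l with busy := false, scanA := Function.update l.scanA j v, pc := .scan j .b }
  | .scan j .b =>
      { l with
        busy := false
        scanB := Function.update l.scanB j v
        pc := if h : (j : ℕ) + 1 < φ then .scan ⟨(j : ℕ) + 1, h⟩ .a else .evalScan }
  | .check .a => { l with busy := false, A := v, pc := .check .b }
  | .check .b => { l with busy := false, B := v, pc := .test }
  | _ => l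

/-- The register (owner and side) that processor `i` reads at a control location, if any.
The predecessor of `i` in the ring is `i - 1` (modulo `n`). -/
def readTarget {n φ : ℕ} [NeZero n] (i : Fin n) : PC φ → Option (Fin n × Side)
  | .readX => some (i, .a)
  | .scan _ r => some (i - 1, r)
  | .check r => some (i, r)
  | _ => none

/-- The control location after the low-level write to the register on the given side. -/
def afterStore {φ : ℕ} : Side → PC φ
  | .a => .store .b
  | .b => .retAWrite

/-- Atomic events. A low-level register operation consists of its invocation and, arbitrarily
later, its response; events of other processors may come in between. -/
inductive Event (n K : ℕ) where
  | idle
  | compute (i : Fin n)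
  | invoke (i : Fin n)
  | readResponse (i : Fin n) (v : Fin K)
  | writeResponse (i : Fin n)

def Config.setLoc {n φ K : ℕ} (c : Config n φ K) (i : Fin n) (l : Local φ K) : Config n φ K :=
  { c with loc := Function.update c.loc i l }

/-- The transition relation. The value of a read response is not restricted here. -/
def Step {n φ K : ℕ} [NeZero n] [NeZero K] (e : Event n K) (c c' : Config n φ K) : Prop :=
  match e with
  | .idle => c' = c
  | .compute i =>
      ¬ (c.loc i).pc.IsRegisterOp ∧ (c.loc i).busy = false ∧
        c' = c.setLoc i ((c.loc i).compute i)
  | .invoke i =>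
      (c.loc i).pc.IsRegisterOp ∧ (c.loc i).busy = false ∧
        c' = c.setLoc i { c.loc i with busy := true }
  | .readResponse i v =>
      readTarget i (c.loc i).pc ≠ none ∧ (c.loc i).busy = true ∧
        c' = c.setLoc i ((c.loc i).receive v)
  | .writeResponse i =>
      (c.loc i).busy = true ∧ ∃ r : Side, (c.loc i).pc = .store r ∧
        c' = { loc := Function.update c.loc i
                 { c.loc i with busy := false, pc := afterStore r }
               reg := Function.update c.reg i
                 (Function.update (c.reg i) r (c.loc i).val) }

/-- A low-level write to register `q` is in progress. -/
def Writing {n φ K : ℕ} (c : Config n φ K) (q : Fin n × Side) : Prop :=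
  (c.loc q.1).pc = .store q.2 ∧ (c.loc q.1).busy = true

/-- Initial states: all variables and all registers are arbitrary (in particular `R_a ≠ R_b` is
allowed), and so is the position of each processor, except that no low-level register operation
and no invocation of `AWrite` is already in progress. -/
def Initial {n φ K : ℕ} (c : Config n φ K) : Prop :=
  ∀ i, (c.loc i).busy = false ∧ ¬ (c.loc i).pc.InAWrite

/-- An execution of the two-register protocol with safe registers. Finite executions are those in
which only `idle` events occur from some time on. -/
structure Execution (n φ K : ℕ) [NeZero n] [NeZero K] where
  conf : ℕ → Config n φ K
  event : ℕ → Event n K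
  init : Initial (conf 0)
  step : ∀ t, Step (event t) (conf t) (conf (t + 1))
  /-- The registers are safe: a low-level read (invoked by event `s`, responding by event `t`) that
  is not concurrent with a write to the same register responds with the content of the register.
  A read that is concurrent with a write may respond with any value in the domain `Fin K`. -/
  safe : ∀ (i : Fin n) (q : Fin n × Side) (s t : ℕ) (v : Fin K),
    s < t → event s = .invoke i → (∀ u, s < u → u ≤ t → ((conf u).loc i).busy = true) →
    event t = .readResponse i v → readTarget i ((conf t).loc i).pc = some q →
    (∀ u, s < u → u ≤ t → ¬ Writing (conf u) q) →
    v = (conf t).reg q.1 q.2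

variable {n φ K : ℕ} [NeZero n] [NeZero K]

/-- Processor `i` invokes `ARead(φ)` by event `s`, and this invocation responds with `r`
by event `t`. -/
def IsARead (E : Execution n φ K) (i : Fin n) (s t : ℕ) (r : Option (Fin K)) : Prop :=
  s < t ∧ ((E.conf s).loc i).pc = .callARead ∧
    (∀ u, s < u → u ≤ t → ((E.conf u).loc i).pc.InARead) ∧
    ¬ ((E.conf (t + 1)).loc i).pc.InARead ∧ r = ((E.conf (t + 1)).loc i).y

/-- Processor `i` invokes `AWrite(v)` by event `w`. -/
def InvokesAWrite (E : Execution n φ K) (i : Fin n) (w : ℕ) (v : Fin K) : Prop :=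
  ((E.conf w).loc i).pc = .callAWrite ∧ ((E.conf (w + 1)).loc i).pc.InAWrite ∧
    v = ((E.conf w).loc i).x

/-- Processor `i` invokes `AWrite` by event `w`, and this invocation returns by event `t`. -/
def IsAWrite (E : Execution n φ K) (i : Fin n) (w t : ℕ) : Prop :=
  w < t ∧ ((E.conf w).loc i).pc = .callAWrite ∧
    (∀ u, w < u → u ≤ t → ((E.conf u).loc i).pc.InAWrite) ∧
    ¬ ((E.conf (t + 1)).loc i).pc.InAWrite

/-- All invocations of `ARead(φ)` by processor `i` are quasi-atomic reads of the register that its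
predecessor `i - 1` writes by `AWrite`.

`src s` is the `AWrite` (named by the time of its invocation; `⊥` for the initial value `x₀`) whose
value is returned by the `ARead(φ)` invoked at time `s`. -/
def QuasiAtomic (E : Execution n φ K) (i : Fin n) : Prop :=
  ∃ (x₀ : Fin K) (src : ℕ → WithBot ℕ),
    (x₀ = (E.conf 0).reg (i - 1) .a ∨ x₀ = (E.conf 0).reg (i - 1) .b) ∧
    -- a response other than `⊥` is the initial value or the argument of an `AWrite` that is invoked
    -- before the `ARead` ends
    (∀ s t v, IsARead E i s t (some v) →
      (src s = ⊥ ∧ v = x₀) ∨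
        ∃ w : ℕ, src s = (w : WithBot ℕ) ∧ InvokesAWrite E (i - 1) w v ∧ w < t) ∧
    -- it is not overwritten by a later `AWrite` that returns before the `ARead` begins
    (∀ s t v, IsARead E i s t (some v) →
      ∀ w t', IsAWrite E (i - 1) w t' → src s < (w : WithBot ℕ) → ¬ t' < s) ∧
    -- there is no new-old inversion
    (∀ s₁ t₁ v₁ s₂ t₂ v₂, IsARead E i s₁ t₁ (some v₁) → IsARead E i s₂ t₂ (some v₂) →
      t₁ < s₂ → src s₁ ≤ src s₂) ∧
    -- `⊥` is returned only if the `ARead` is concurrent with some `AWrite`, or if the two registers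
    -- disagree initially and no `AWrite` has been completed before the `ARead`
    (∀ s t, IsARead E i s t none →
      (∃ w v, InvokesAWrite E (i - 1) w v ∧ w < t ∧ ∀ t', IsAWrite E (i - 1) w t' → s < t') ∨
      ((E.conf 0).reg (i - 1) .a ≠ (E.conf 0).reg (i - 1) .b ∧
        ∀ w t', IsAWrite E (i - 1) w t' → ¬ t' < s))

end TwoRegRing

namespace TwoRegRing

/-! Every `AWrite` is made to take effect at one instant: when its write to `R_a` completes, or when
its test finds its argument already in both registers. The abstract value `curVal` is the content of
`R_a`, except that before the first completed write to `R_a` it is the initial content of `R_b`. A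
scan with two equal reads, during which no write to `R_a` completes, returns an abstract value
(`FullScan.exists_curVal`). By pigeonhole over the disjoint scans, so does an `ARead(φ)` with
response other than `⊥` during which the writer completes fewer than `φ` writes to `R_a`
(`IsARead.exists_curVal`).

It remains to count writes. The reader writes nothing during its own `ARead(φ)`. A processor that
completes `m < φ` writes to `R_a` shows at most `m + 1` successive abstract values. After one
unaccounted write, its successor changes `R_a` only in reaction to a new one of these, since the
update rule is idempotent (`newX_newX`) and `AWrite` skips a value already stored. So the successor
completes at most `m + 2` writes (`cnt_succ_le`). Going around the ring from the reader to its
predecessor gives at most `2 * (n - 1) < φ` writes (`IsARead.cnt_lt`).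

Each `ARead(φ)` with response other than `⊥` thus has a point `σ` inside its interval where its
response is the abstract value; its source is the latest `AWrite` effective at `σ`. Monotonicity of
`own` excludes overwritten sources and new-old inversions. The clause on `⊥` is independent of the
counting: an idle writer with equal registers makes all reads unanimous. -/

variable {n φ K : ℕ} [NeZero n] [NeZero K]

/-! ### Auxiliary variables and the effect of an event on one processor -/

/-- Auxiliary variables of a processor: the number of completed writes to its register `R_a`, the
time of its latest `AWrite` invocation, and the latest `AWrite` that has taken effect on `R_a`. -/
structure Ghost where
  cnt : ℕ
  inv : ℕ
  own : WithBot ℕ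

open Classical in
/-- Update of the auxiliary variables by the event at time `t`, which moves control
from `p` to `p'`. -/
noncomputable def Ghost.next (t : ℕ) (p p' : PC φ) (g : Ghost) : Ghost where
  cnt := if p = .store .a ∧ p' = .store .b then g.cnt + 1 else g.cnt
  inv := if p = .callAWrite ∧ p' = .check .a then t else g.inv
  own := if (p = .store .a ∧ p' = .store .b) ∨ (p = .test ∧ p' = .retAWrite)
    then (g.inv : WithBot ℕ) else g.own

/-- The auxiliary variables of processor `i` along an execution. -/
noncomputable def ghost (E : Execution n φ K) (i : Fin n) : ℕ → Ghost
  | 0 => ⟨0, 0, ⊥⟩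
  | t + 1 => (ghost E i t).next t ((E.conf t).loc i).pc ((E.conf (t + 1)).loc i).pc

/-- The event `ev` at time `t` seen by processor `i`: change of its local state, of its registers,
and of its auxiliary variables. -/
inductive Move (i : Fin n) (t : ℕ) (ev : Event n K) (l : Local φ K) (r : Side → Fin K) (g : Ghost)
    (l' : Local φ K) (r' : Side → Fin K) (g' : Ghost) : Prop
  | stay (hl : l' = l) (hr : r' = r) (hg : g' = g)
  | invoke (h : l.pc.IsRegisterOp) (hl : l' = { l with busy := true }) (hr : r' = r) (hg : g' = g)
  | readX (h : l.pc = .readX) (hl : l' = { l with busy := false, x := r .a, pc := .callARead })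
      (hr : r' = r) (hg : g' = g)
  | callARead (h : l.pc = .callARead)
      (hl : l' = { l with pc := if h : 0 < φ then .scan ⟨0, h⟩ .a else .evalScan })
      (hr : r' = r) (hg : g' = g)
  | scan (j : Fin φ) (d : Side) (v : Fin K) (h : l.pc = .scan j d) (hb : l.busy = true)
      (he : ev = .readResponse i v) (hl : l' = l.receive v) (hr : r' = r) (hg : g' = g)
  | evalScan (h : l.pc = .evalScan)
      (hl : l' = { l with y := scanResult l.scanA l.scanB, pc := .guards })
      (hr : r' = r) (hg : g' = g)
  | guards (h : l.pc = .guards) (hl : l' = { l with x := newX i l.x l.y, pc := .callAWrite })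
      (hr : r' = r) (hg : g' = g)
  | callAWrite (h : l.pc = .callAWrite) (hl : l' = { l with val := l.x, pc := .check .a })
      (hr : r' = r) (hg : g' = { g with inv := t })
  | checkA (h : l.pc = .check .a) (hl : l' = { l with busy := false, A := r .a, pc := .check .b })
      (hr : r' = r) (hg : g' = g)
  | checkB (h : l.pc = .check .b) (hl : l' = { l with busy := false, B := r .b, pc := .test })
      (hr : r' = r) (hg : g' = g)
  | skip (h : l.pc = .test) (hA : l.A = l.val) (hB : l.B = l.val)
      (hl : l' = { l with pc := .retAWrite }) (hr : r' = r) (hg : g' = { g with own := g.inv })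
  | change (h : l.pc = .test) (hv : ¬ (l.A = l.val ∧ l.B = l.val))
      (hl : l' = { l with pc := .store .a }) (hr : r' = r) (hg : g' = g)
  | storeA (h : l.pc = .store .a) (hl : l' = { l with busy := false, pc := .store .b })
      (hr : r' = Function.update r .a l.val)
      (hg : g' = { g with cnt := g.cnt + 1, own := g.inv })
  | storeB (h : l.pc = .store .b) (hl : l' = { l with busy := false, pc := .retAWrite })
      (hr : r' = Function.update r .b l.val) (hg : g' = g)
  | ret (h : l.pc = .retAWrite) (hl : l' = { l with pc := .readX }) (hr : r' = r) (hg : g' = g)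

/-- An event of `E` acts on processor `i` by one of its own statements or not at all. -/
lemma Execution.step_cases (E : Execution n φ K) (i : Fin n) (t : ℕ) :
    ((E.conf (t + 1)).loc i = (E.conf t).loc i ∧ (E.conf (t + 1)).reg i = (E.conf t).reg i) ∨
    (E.event t = .compute i ∧ ¬ ((E.conf t).loc i).pc.IsRegisterOp ∧
      (E.conf (t + 1)).loc i = ((E.conf t).loc i).compute i ∧
      (E.conf (t + 1)).reg i = (E.conf t).reg i) ∨
    (E.event t = .invoke i ∧ ((E.conf t).loc i).pc.IsRegisterOp ∧
      (E.conf (t + 1)).loc i = { (E.conf t).loc i with busy := true } ∧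
      (E.conf (t + 1)).reg i = (E.conf t).reg i) ∨
    (∃ v, E.event t = .readResponse i v ∧ readTarget i ((E.conf t).loc i).pc ≠ none ∧
      ((E.conf t).loc i).busy = true ∧
      (E.conf (t + 1)).loc i = ((E.conf t).loc i).receive v ∧
      (E.conf (t + 1)).reg i = (E.conf t).reg i) ∨
    (∃ r, E.event t = .writeResponse i ∧ ((E.conf t).loc i).pc = .store r ∧
      (E.conf (t + 1)).loc i = { (E.conf t).loc i with busy := false, pc := afterStore r } ∧
      (E.conf (t + 1)).reg i = Function.update ((E.conf t).reg i) r ((E.conf t).loc i).val) := by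
  have hs := E.step t
  cases he : E.event t with
  | idle => rw [he] at hs; simp only [Step] at hs; simp [hs]
  | compute j =>
    rw [he] at hs; obtain ⟨h1, h2, h3⟩ := hs
    by_cases hij : i = j
    · subst hij; simp [h3, Config.setLoc, h1]
    · simp [h3, Config.setLoc, hij]
  | invoke j =>
    rw [he] at hs; obtain ⟨h1, h2, h3⟩ := hs
    by_cases hij : i = j
    · subst hij; simp [h3, Config.setLoc, h1]
    · simp [h3, Config.setLoc, hij]
  | readResponse j v =>
    rw [he] at hs; obtain ⟨h1, h2, h3⟩ := hs
    by_cases hij : i = j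
    · subst hij; simp [h3, Config.setLoc, h1, h2]
    · simp [h3, Config.setLoc, hij]
  | writeResponse j =>
    rw [he] at hs; obtain ⟨h1, r, h2, h3⟩ := hs
    by_cases hij : i = j
    · subst hij; right; right; right; right; exact ⟨r, rfl, h2, by simp [h3], by simp [h3]⟩
    · left; simp [h3, hij]

/-! ### Low-level reads and safeness -/

/-- A low-level read of register `q` by processor `i`, from event `a` to event `b`,
responds with `v`. -/
structure IsRead (E : Execution n φ K) (i : Fin n) (a b : ℕ) (q : Fin n × Side) (v : Fin K) :
    Prop where
  lt : a < b
  invoke : E.event a = .invoke i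
  busy : ∀ u, a < u → u ≤ b → ((E.conf u).loc i).busy = true
  response : E.event b = .readResponse i v
  target : readTarget i ((E.conf b).loc i).pc = some q

lemma IsRead.eq_reg {E : Execution n φ K} {i : Fin n} {a b : ℕ} {q : Fin n × Side} {v : Fin K}
    (h : IsRead E i a b q v) (hq : ∀ u, a < u → u ≤ b → ¬ Writing (E.conf u) q) :
    v = (E.conf b).reg q.1 q.2 :=
  E.safe i q a b v h.lt h.invoke h.busy h.response h.target hq

lemma Local.receive_busy {n φ K : ℕ} [NeZero n] (l : Local φ K) (v : Fin K) {i : Fin n}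
    (h : readTarget i l.pc ≠ none) :
    (l.receive v).busy = false := by
  rcases l with ⟨pc, _⟩
  cases pc <;> simp_all [readTarget, Local.receive]
  all_goals rename_i d; cases d <;> rfl

/-- A low-level operation in progress has been invoked. -/
lemma exists_invoke (E : Execution n φ K) (i : Fin n) (u : ℕ)
    (hu : ((E.conf u).loc i).busy = true) :
    ∃ a < u, E.event a = .invoke i ∧
      (∀ w, a < w → w ≤ u → ((E.conf w).loc i).busy = true) ∧
      ∀ w, a ≤ w → w ≤ u → ((E.conf w).loc i).pc = ((E.conf u).loc i).pc := by
  induction u with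
  | zero => simp [(E.init i).1] at hu
  | succ u ih =>
    have extend : ((E.conf (u + 1)).loc i).pc = ((E.conf u).loc i).pc →
        ((E.conf u).loc i).busy = true → ∃ a < u + 1, E.event a = .invoke i ∧
      (∀ w, a < w → w ≤ u + 1 → ((E.conf w).loc i).busy = true) ∧
      ∀ w, a ≤ w → w ≤ u + 1 → ((E.conf w).loc i).pc = ((E.conf (u + 1)).loc i).pc := by
      intro h hb
      obtain ⟨a, ha, he, h1, h2⟩ := ih hb
      refine ⟨a, by omega, he, fun w hw hw' => ?_, fun w hw hw' => ?_⟩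
      · rcases Nat.lt_or_eq_of_le hw' with h' | rfl
        · exact h1 w hw (by omega)
        · exact hu
      · rcases Nat.lt_or_eq_of_le hw' with h' | rfl
        · rw [h]; exact h2 w hw (by omega)
        · rfl
    rcases E.step_cases i u with h | h | h | ⟨v, h⟩ | ⟨r, h⟩
    · exact extend (by rw [h.1]) (by rw [← h.1]; exact hu)
    · obtain ⟨he, -, hl, -⟩ := h
      have hs := E.step u
      rw [he] at hs
      have hb := hs.2.1
      rw [hl] at hu
      exfalso
      revert hu
      unfold Local.compute
      split <;> simp [hb]
    · obtain ⟨he, -, hl, -⟩ := h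
      refine ⟨u, by omega, he, fun w hw hw' => ?_, fun w hw hw' => ?_⟩
      · obtain rfl : w = u + 1 := by omega
        exact hu
      · obtain rfl | rfl : w = u + 1 ∨ w = u := by omega
        · rfl
        · rw [hl]
    · rw [h.2.2.2.1, Local.receive_busy _ _ h.2.1] at hu
      simp at hu
    · rw [h.2.2.1] at hu
      simp at hu

/-- A read response ends a low-level read during which control did not move. -/
lemma exists_isRead (E : Execution n φ K) (i : Fin n) (u : ℕ) (v : Fin K) (q : Fin n × Side)
    (hb : ((E.conf u).loc i).busy = true) (he : E.event u = .readResponse i v)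
    (hq : readTarget i ((E.conf u).loc i).pc = some q) :
    ∃ a, IsRead E i a u q v ∧
      ∀ w, a ≤ w → w ≤ u → ((E.conf w).loc i).pc = ((E.conf u).loc i).pc := by
  obtain ⟨a, ha, he', h1, h2⟩ := exists_invoke E i u hb
  exact ⟨a, ⟨ha, he', h1, he, hq⟩, h2⟩

/-- A processor reads its own registers correctly. -/
lemma own_read (E : Execution n φ K) (i : Fin n) (u : ℕ) (v : Fin K) (d : Side)
    (hb : ((E.conf u).loc i).busy = true) (he : E.event u = .readResponse i v)
    (hq : readTarget i ((E.conf u).loc i).pc = some (i, d)) :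
    v = (E.conf u).reg i d := by
  obtain ⟨a, h, h2⟩ := exists_isRead E i u v _ hb he hq
  refine h.eq_reg fun w hw hw' hW => ?_
  have := hW.1
  rw [h2 w hw.le hw'] at this
  rw [this] at hq
  simp [readTarget] at hq

/-- All later invariants are proved by cases on `Move`. Safeness is already used up here for reads
of own registers, which never overlap an own write; the value received in a scan stays arbitrary,
because the predecessor may be writing. -/
lemma Execution.move (E : Execution n φ K) (i : Fin n) (t : ℕ) :
    Move i t (E.event t) ((E.conf t).loc i) ((E.conf t).reg i) (ghost E i t)
      ((E.conf (t + 1)).loc i) ((E.conf (t + 1)).reg i) (ghost E i (t + 1)) := by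
  have hg : ghost E i (t + 1) =
    (ghost E i t).next t ((E.conf t).loc i).pc ((E.conf (t + 1)).loc i).pc := rfl
  rw [hg]
  rcases E.step_cases i t with ⟨hl, hr⟩ | ⟨he, h, hl, hr⟩ | ⟨he, h, hl, hr⟩ |
    ⟨v, he, h, hb, hl, hr⟩ | ⟨d, he, h, hl, hr⟩
  · refine .stay hl hr ?_
    rw [hl]; unfold Ghost.next; cases (((E.conf t).loc i).pc) <;> simp
    split_ifs with h1
    · rcases h1 with ⟨h1, h2⟩; rw [h1] at h2; cases h2
    · rfl
  · unfold Local.compute at hl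
    cases hp : ((E.conf t).loc i).pc with
    | readX => simp [hp, PC.IsRegisterOp] at h
    | scan => simp [hp, PC.IsRegisterOp] at h
    | check => simp [hp, PC.IsRegisterOp] at h
    | store => simp [hp, PC.IsRegisterOp] at h
    | callARead =>
      rw [hp] at hl
      exact .callARead hp hl hr (by simp [Ghost.next])
    | evalScan =>
      rw [hp] at hl
      exact .evalScan hp hl hr (by simp [Ghost.next])
    | guards =>
      rw [hp] at hl
      exact .guards hp hl hr (by simp [Ghost.next])
    | callAWrite =>
      rw [hp] at hl
      exact .callAWrite hp hl hr (by simp [Ghost.next, hl])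
    | test =>
      rw [hp] at hl
      by_cases hv : ((E.conf t).loc i).A = ((E.conf t).loc i).val ∧
        ((E.conf t).loc i).B = ((E.conf t).loc i).val
      · exact .skip hp hv.1 hv.2 (by simpa [hv] using hl) hr (by simp [Ghost.next, hl, hv])
      · simp only [if_neg hv] at hl
        exact .change hp hv hl hr (by simp [Ghost.next, hl])
    | retAWrite =>
      rw [hp] at hl
      exact .ret hp hl hr (by simp [Ghost.next])
  · refine .invoke h hl hr ?_
    rw [hl]; unfold Ghost.next; cases (((E.conf t).loc i).pc) <;> simp
    split_ifs with h1
    · rcases h1 with ⟨h1, h2⟩; rw [h1] at h2; cases h2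
    · rfl
  · cases hp : ((E.conf t).loc i).pc with
    | callARead => simp [hp, readTarget] at h
    | evalScan => simp [hp, readTarget] at h
    | guards => simp [hp, readTarget] at h
    | callAWrite => simp [hp, readTarget] at h
    | test => simp [hp, readTarget] at h
    | store => simp [hp, readTarget] at h
    | retAWrite => simp [hp, readTarget] at h
    | readX =>
      have := own_read E i t v .a hb he (by simp [hp, readTarget])
      subst this
      unfold Local.receive at hl
      rw [hp] at hl
      exact .readX hp hl hr (by simp [Ghost.next])
    | scan j d => exact .scan j d v hp hb he hl hr (by simp [Ghost.next])
    | check d =>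
      have := own_read E i t v d hb he (by simp [hp, readTarget])
      subst this
      unfold Local.receive at hl
      rw [hp] at hl
      cases d with
      | a => exact .checkA hp hl hr (by simp [Ghost.next])
      | b => exact .checkB hp hl hr (by simp [Ghost.next])
  · cases d with
    | a => exact .storeA h hl hr (by simp [Ghost.next, h, hl, afterStore])
    | b => exact .storeB h hl hr (by simp [Ghost.next, h])

/-- After a read response in a scan, control is still inside `ARead(φ)`. -/
lemma Local.receive_scan {φ K : ℕ} (l : Local φ K) (v : Fin K) {j : Fin φ} {d : Side}
    (h : l.pc = .scan j d) :
    ((∃ j' d', (l.receive v).pc = .scan j' d') ∨ (l.receive v).pc = .evalScan) ∧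
      (l.receive v).x = l.x := by
  unfold Local.receive
  rw [h]
  cases d
  · simp
  · simp only [and_true]
    split <;> simp

lemma PC.callARead_next {φ : ℕ} :
    (∃ j d, (if h : 0 < φ then .scan ⟨0, h⟩ .a else .evalScan : PC φ) = .scan j d) ∨
    (if h : 0 < φ then .scan ⟨0, h⟩ .a else .evalScan : PC φ) = .evalScan := by
  split <;> simp

/-! ### Invariants of a single writer -/

/-- Relation between registers, local variables of `AWrite` and auxiliary variables. -/
structure RegInv (E : Execution n φ K) (i : Fin n) (u : ℕ) : Prop where
  own_bot : (ghost E i u).own = ⊥ → (ghost E i u).cnt = 0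
  cnt_zero : (ghost E i u).cnt = 0 →
    (E.conf u).reg i = (E.conf 0).reg i ∧ ((E.conf u).loc i).pc ≠ .store .b
  cnt_pos : (ghost E i u).cnt ≠ 0 → ((E.conf u).loc i).pc ≠ .store .b →
    (E.conf u).reg i .b = (E.conf u).reg i .a
  own_ne : (ghost E i u).own ≠ ⊥ → ((E.conf u).loc i).pc ≠ .store .b →
    (E.conf u).reg i .b = (E.conf u).reg i .a
  storeB : ((E.conf u).loc i).pc = .store .b →
    (E.conf u).reg i .a = ((E.conf u).loc i).val
  checkB : ((E.conf u).loc i).pc = .check .b →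
    ((E.conf u).loc i).A = (E.conf u).reg i .a
  test : ((E.conf u).loc i).pc = .test →
    ((E.conf u).loc i).A = (E.conf u).reg i .a ∧ ((E.conf u).loc i).B = (E.conf u).reg i .b

lemma Initial.pc_ne {n φ K : ℕ} {c : Config n φ K} (h : Initial c) (i : Fin n) :
    (∀ d, (c.loc i).pc ≠ .check d) ∧ (c.loc i).pc ≠ .test ∧ (∀ d, (c.loc i).pc ≠ .store d) ∧
      (c.loc i).pc ≠ .retAWrite := by
  have := (h i).2
  refine ⟨fun d h => ?_, fun h => ?_, fun d h => ?_, fun h => ?_⟩ <;> simp [h, PC.InAWrite] at this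

/-- Once an `AWrite` has taken effect, the two registers differ only between the two stores of one
`AWrite`. The copies `A` and `B` remain accurate up to the test because only the owner writes these
registers. -/
lemma regInv (E : Execution n φ K) (i : Fin n) (u : ℕ) : RegInv E i u := by
  induction u with
  | zero =>
    have := E.init.pc_ne i
    constructor <;> simp [this, ghost]
  | succ u ih =>
    have hm := E.move i u
    obtain ⟨h1, h2, h3, h4, h5, h6, h7⟩ := ih
    generalize E.event u = ev, (E.conf u).loc i = l, (E.conf u).reg i = r,
      ghost E i u = g at *
    cases hm with
    | callARead h hl hr hg =>
      rcases PC.callARead_next (φ := φ) with ⟨j, d, hp⟩ | hp <;> rw [hp] at hl <;>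
      constructor <;> simp_all
    | scan j d v h hb he hl hr hg =>
      obtain ⟨⟨j, d, hp⟩ | hp, hx⟩ := l.receive_scan v h <;>
      constructor <;> simp_all
    | invoke h hl hr hg => constructor <;> simp_all
    | skip h hA hB hl hr hg =>
      have := h7 h
      -- A successful test is itself evidence that the registers agree, even if nothing has been
      -- written yet.
      have : r .b = r .a := by rw [← this.1, ← this.2, hA, hB]
      constructor <;> simp_all
    | _ => constructor <;> simp_all

lemma inv_le (E : Execution n φ K) (i : Fin n) (u : ℕ) : (ghost E i u).inv ≤ u := by
  induction u with
  | zero => simp [ghost]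
  | succ u ih =>
    have hm := E.move i u
    cases hm <;> simp_all <;> omega

lemma own_le (E : Execution n φ K) (i : Fin n) (u : ℕ) :
    (ghost E i u).own ≤ ((ghost E i u).inv : WithBot ℕ) := by
  induction u with
  | zero => simp [ghost]
  | succ u ih =>
    have hm := E.move i u
    have h : ((ghost E i u).inv : WithBot ℕ) ≤ (u : WithBot ℕ) := by exact_mod_cast inv_le E i u
    cases hm with
    | callAWrite h hl hr hg => rw [hg]; exact ih.trans ‹_›
    | _ => simp_all

/-- Within an `AWrite`, control has stayed there since its invocation, and `val` is its argument. -/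
lemma inAWrite_inv (E : Execution n φ K) (i : Fin n) (u : ℕ)
    (hu : ((E.conf u).loc i).pc.InAWrite) : (ghost E i u).inv < u ∧
    InvokesAWrite E i (ghost E i u).inv ((E.conf u).loc i).val ∧
    ∀ w, (ghost E i u).inv < w → w ≤ u → ((E.conf w).loc i).pc.InAWrite := by
  induction u with
  | zero => exact absurd hu (E.init i).2
  | succ u ih =>
    by_cases hc : ((E.conf u).loc i).pc = .callAWrite ∧ ((E.conf (u + 1)).loc i).pc ≠ .callAWrite
    · have h : (ghost E i (u + 1)).inv = u ∧
          ((E.conf (u + 1)).loc i).val = ((E.conf u).loc i).x := by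
        have hm := E.move i u
        cases hm with
        | stay hl hr hg => simp_all
        | invoke h hl hr hg => simp_all
        | _ => simp_all
      rw [h.1, h.2]
      refine ⟨by omega, ⟨hc.1, hu, rfl⟩, fun w hw hw' => ?_⟩
      obtain rfl : w = u + 1 := by omega
      exact hu
    · have h : (ghost E i (u + 1)).inv = (ghost E i u).inv ∧ ((E.conf u).loc i).pc.InAWrite ∧
          ((E.conf (u + 1)).loc i).val = ((E.conf u).loc i).val := by
        have hm := E.move i u
        clear ih
        cases hm with
        | stay hl hr hg => simp_all
        | invoke h hl hr hg => simp_all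
        | callARead h hl hr hg =>
          rcases PC.callARead_next (φ := φ) with ⟨j, d, hp⟩ | hp <;> rw [hp] at hl <;>
          simp_all [PC.InAWrite]
        | scan j d v h hb he hl hr hg =>
          obtain ⟨⟨j, d, hp⟩ | hp, hx⟩ := Local.receive_scan _ v h <;> simp_all [PC.InAWrite]
        | _ => simp_all [PC.InAWrite]
      obtain ⟨h1, h2, h3⟩ := ih h.2.1
      rw [h.1, h.2.2]
      refine ⟨by omega, h2, fun w hw hw' => ?_⟩
      rcases Nat.lt_or_eq_of_le hw' with h' | rfl
      · exact h3 w hw (by omega)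
      · exact hu

/-- These locations are reached only through the store to `R_a` or a successful test, the two places
where the current `AWrite` takes effect. -/
lemma own_eq_inv (E : Execution n φ K) (i : Fin n) (u : ℕ)
    (hu : ((E.conf u).loc i).pc = .retAWrite ∨ ((E.conf u).loc i).pc = .store .b) :
    (ghost E i u).own = ((ghost E i u).inv : WithBot ℕ) := by
  induction u with
  | zero =>
    have := E.init.pc_ne i
    simp_all
  | succ u ih =>
    have hm := E.move i u
    cases hm with
    | callARead h hl hr hg =>
      rcases PC.callARead_next (φ := φ) with ⟨j, d, hp⟩ | hp <;> rw [hp] at hl <;> simp_all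
    | scan j d v h hb he hl hr hg =>
      obtain ⟨⟨j, d, hp⟩ | hp, hx⟩ := Local.receive_scan _ v h <;> simp_all
    | _ => simp_all

/-- The latest effective `AWrite` has the content of `R_a` as argument. -/
lemma own_value (E : Execution n φ K) (i : Fin n) (u w : ℕ)
    (hw : (ghost E i u).own = (w : WithBot ℕ)) :
    w < u ∧ InvokesAWrite E i w ((E.conf u).reg i .a) := by
  induction u with
  | zero => simp [ghost] at hw
  | succ u ih =>
    have hm := E.move i u
    have h7 := (regInv E i u).test
    have h8 := inAWrite_inv E i u
    cases hm with
    | skip h hA hB hl hr hg =>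
      have h8 := h8 (by simp [h, PC.InAWrite])
      have h7 := h7 h
      simp only [hg] at hw
      obtain rfl : (ghost E i u).inv = w := by exact_mod_cast hw
      rw [hr, ← h7.1, hA]
      exact ⟨by omega, h8.2.1⟩
    | storeA h hl hr hg =>
      have h8 := h8 (by simp [h, PC.InAWrite])
      simp only [hg] at hw
      obtain rfl : (ghost E i u).inv = w := by exact_mod_cast hw
      rw [hr, Function.update_self]
      exact ⟨by omega, h8.2.1⟩
    | storeB h hl hr hg =>
      rw [hg] at hw
      rw [hr, Function.update_of_ne (by simp)]
      exact ⟨(ih hw).1.trans u.lt_succ_self, (ih hw).2⟩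
    | _ =>
      have hw : (ghost E i u).own = w := by simp_all
      have hr : (E.conf (u + 1)).reg i = (E.conf u).reg i := by assumption
      rw [hr]
      exact ⟨(ih hw).1.trans u.lt_succ_self, (ih hw).2⟩

/-! ### The abstract register value and its source -/

/-- The value of the register that `i` writes by `AWrite`: the content of `R_a`, or the initial
content of `R_b` as long as `R_a` has not been written. -/
noncomputable def curVal (E : Execution n φ K) (i : Fin n) (u : ℕ) : Fin K :=
  if (ghost E i u).cnt = 0 then (E.conf 0).reg i .b else (E.conf u).reg i .a

lemma cnt_mono (E : Execution n φ K) (i : Fin n) : Monotone fun u => (ghost E i u).cnt := by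
  refine monotone_nat_of_le_succ fun u => ?_
  have hm := E.move i u
  cases hm <;> simp_all

lemma inv_mono (E : Execution n φ K) (i : Fin n) : Monotone fun u => (ghost E i u).inv := by
  refine monotone_nat_of_le_succ fun u => ?_
  have hm := E.move i u
  have := inv_le E i u
  cases hm <;> simp_all

lemma own_mono (E : Execution n φ K) (i : Fin n) : Monotone fun u => (ghost E i u).own := by
  refine monotone_nat_of_le_succ fun u => ?_
  have hm := E.move i u
  have := own_le E i u
  cases hm <;> simp_all

/-- Stores to `R_b` do not affect the abstract value, so `cnt` numbers its successive versions. -/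
lemma curVal_eq (E : Execution n φ K) (i : Fin n) {u w : ℕ} (h : u ≤ w)
    (hc : (ghost E i u).cnt = (ghost E i w).cnt) : curVal E i u = curVal E i w := by
  induction w, h using Nat.le_induction with
  | base => rfl
  | succ w hw ih =>
    have h1 : _ ≤ _ := cnt_mono E i hw
    have h2 : _ ≤ _ := cnt_mono E i (show w ≤ w + 1 by omega)
    dsimp only at h1 h2
    rw [ih (by omega)]
    have hc' : (ghost E i (w + 1)).cnt = (ghost E i w).cnt := by omega
    have hm := E.move i w
    unfold curVal
    cases hm <;> simp_all [Function.update]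

lemma curVal_own (E : Execution n φ K) (i : Fin n) (u : ℕ) :
    ((ghost E i u).own = ⊥ ∧ curVal E i u = (E.conf 0).reg i .b) ∨
      ∃ w : ℕ, (ghost E i u).own = (w : WithBot ℕ) ∧ InvokesAWrite E i w (curVal E i u) ∧
        w < u := by
  have hr := regInv E i u
  cases ho : (ghost E i u).own with
  | bot => left; exact ⟨rfl, by simp [curVal, hr.own_bot ho]⟩
  | coe w =>
    right
    obtain ⟨h1, h2⟩ := own_value E i u w ho
    refine ⟨w, rfl, ?_, h1⟩
    unfold curVal
    -- An `AWrite` effective before any write to `R_a` has passed its test on the initial contents,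
    -- so these agree and the initial `R_b` is its argument as well.
    split_ifs with hc
    · have := hr.cnt_zero hc
      rw [← this.1, hr.own_ne (by simp [ho]) this.2]; exact h2
    · exact h2

/-- A completed `AWrite` has taken effect. -/
lemma IsAWrite.le_own {E : Execution n φ K} {i : Fin n} {w t u : ℕ} (h : IsAWrite E i w t)
    (hu : t < u) : (w : WithBot ℕ) ≤ (ghost E i u).own := by
  obtain ⟨h1, h2, h3, h4⟩ := h
  have h5 := h3 t h1 le_rfl
  have hinv : (ghost E i (w + 1)).inv = w := by
    have hw := h3 (w + 1) (by omega) (by omega)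
    have hm := E.move i w
    cases hm with
    | stay hl hr hg => rw [hl, h2] at hw; simp [PC.InAWrite] at hw
    | invoke h hl hr hg => rw [hl, h2] at hw; simp [PC.InAWrite] at hw
    | _ => simp_all
  have hw : w ≤ (ghost E i t).inv := by
    have : _ ≤ _ := inv_mono E i (show w + 1 ≤ t from h1)
    simpa [hinv] using this
  have hown : (ghost E i t).own = ((ghost E i t).inv : WithBot ℕ) := by
    refine own_eq_inv E i t ?_
    have hm := E.move i t
    cases hm with
    | callARead h hl hr hg => simp_all [PC.InAWrite]
    | scan j d v h hb he hl hr hg => simp_all [PC.InAWrite]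
    | _ => simp_all [PC.InAWrite]
  have h6 : _ ≤ _ := own_mono E i hu.le
  calc (w : WithBot ℕ) ≤ ((ghost E i t).inv : WithBot ℕ) := by exact_mod_cast hw
    _ ≤ _ := by rw [← hown]; exact h6

/-! ### The low-level reads that make up an `ARead(φ)` -/

/-- Scan `j` has been performed between `s` and `u`, with results `v` for `R_a` and
`v'` for `R_b`. -/
structure FullScan (E : Execution n φ K) (i : Fin n) (s u : ℕ) (j : Fin φ) (v v' : Fin K)
    (a₁ a₂ b₁ b₂ : ℕ) : Prop where
  left : s < a₁
  mid : a₂ < b₁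
  right : b₂ < u
  pc : ∀ w, a₁ ≤ w → w ≤ b₂ → ∃ d, ((E.conf w).loc i).pc = .scan j d
  readA : IsRead E i a₁ a₂ (i - 1, .a) v
  readB : IsRead E i b₁ b₂ (i - 1, .b) v'

/-- The reads performed so far by an invocation of `ARead(φ)` at time `s`. -/
def ScanInv (E : Execution n φ K) (i : Fin n) (s u : ℕ) (l : Local φ K) : Prop :=
  match l.pc with
  | .scan j d => (∀ j' < j, ∃ a₁ a₂ b₁ b₂,
        FullScan E i s u j' (l.scanA j') (l.scanB j') a₁ a₂ b₁ b₂) ∧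
      (d = .b → ∃ a₁ a₂, s < a₁ ∧ a₂ < u ∧
        (∀ w, a₁ ≤ w → w ≤ u → ∃ d, ((E.conf w).loc i).pc = .scan j d) ∧
        ((E.conf a₂).loc i).pc = .scan j .a ∧
        IsRead E i a₁ a₂ (i - 1, .a) (l.scanA j))
  | .evalScan => ∀ j', ∃ a₁ a₂ b₁ b₂,
        FullScan E i s u j' (l.scanA j') (l.scanB j') a₁ a₂ b₁ b₂
  | _ => True

lemma FullScan.mono {E : Execution n φ K} {i : Fin n} {s u u' : ℕ} {j : Fin φ} {v v' : Fin K}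
    (huu : u ≤ u')
    (h : ∃ a₁ a₂ b₁ b₂, FullScan E i s u j v v' a₁ a₂ b₁ b₂) :
    ∃ a₁ a₂ b₁ b₂, FullScan E i s u' j v v' a₁ a₂ b₁ b₂ := by
  obtain ⟨a₁, a₂, b₁, b₂, h⟩ := h
  exact ⟨a₁, a₂, b₁, b₂, { h with right := h.right.trans_le huu }⟩

lemma scanInv (E : Execution n φ K) (i : Fin n) (s : ℕ)
    (hs : ((E.conf s).loc i).pc = .callARead) (u : ℕ) (hsu : s < u)
    (hu : ∀ w, s < w → w ≤ u → ((E.conf w).loc i).pc.InARead) :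
    ScanInv E i s u ((E.conf u).loc i) := by
  induction u, hsu using Nat.le_induction with
  | base =>
    have h1 := hu (s + 1) (by omega) le_rfl
    have hm := E.move i s
    cases hm with
    | stay hl hr hg => rw [hl, hs] at h1; simp [PC.InARead] at h1
    | invoke h hl hr hg => rw [hl, hs] at h1; simp [PC.InARead] at h1
    | callARead h hl hr hg =>
      rw [hl]
      unfold ScanInv
      by_cases hφ : 0 < φ
      · simp only [hφ, dite_true]
        exact ⟨fun j' hj' => absurd hj' (by simp [Fin.lt_def]), by simp⟩
      · simp only [hφ, dite_false]
        exact fun j' => absurd j'.pos hφ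
    | _ => simp_all
  | succ u hsu ih =>
    have ih := ih fun w h1 h2 => hu w h1 (h2.trans u.le_succ)
    have h0 := hu u hsu (by omega)
    have h1 := hu (u + 1) (by omega) le_rfl
    have hm := E.move i u
    have keep : ((E.conf (u + 1)).loc i).pc = ((E.conf u).loc i).pc →
        ((E.conf (u + 1)).loc i).scanA = ((E.conf u).loc i).scanA →
        ((E.conf (u + 1)).loc i).scanB = ((E.conf u).loc i).scanB →
        ScanInv E i s (u + 1) ((E.conf (u + 1)).loc i) := by
      intro hp hA hB
      unfold ScanInv at ih ⊢
      rw [hp, hA, hB]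
      cases hpc : ((E.conf u).loc i).pc with
      | scan j d =>
        rw [hpc] at ih
        dsimp only at ih ⊢
        refine ⟨fun j' hj' => FullScan.mono u.le_succ (ih.1 j' hj'), fun hd => ?_⟩
        obtain ⟨a₁, a₂, h1, h2, h3, h4, h5⟩ := ih.2 hd
        refine ⟨a₁, a₂, h1, by omega, fun w hw hw' => ?_, h4, h5⟩
        rcases Nat.lt_or_eq_of_le hw' with h' | rfl
        · exact h3 w hw (by omega)
        · exact ⟨d, hp.trans hpc⟩
      | evalScan =>
        rw [hpc] at ih
        exact fun j' => FullScan.mono u.le_succ (ih j')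
      | _ => trivial
    cases hm with
    | stay hl hr hg => exact keep (by rw [hl]) (by rw [hl]) (by rw [hl])
    | invoke h hl hr hg => exact keep (by rw [hl]) (by rw [hl]) (by rw [hl])
    | scan j d v h hb he hl hr hg =>
      obtain ⟨a, hread, hpc⟩ := exists_isRead E i u v (i - 1, d) hb he (by simp [h, readTarget])
      rw [h] at hpc
      -- Control does not move during a low-level read, so a read invoked by time `s` would place
      -- control in a scan at `s`.
      have hsa : s < a := by
        by_contra hc
        have := hpc s (by omega) (by omega)
        rw [hs] at this
        cases this
      unfold ScanInv at ih
      rw [h] at ih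
      obtain ⟨ih1, ih2⟩ := ih
      cases d with
      | a =>
        have hl' : (E.conf (u + 1)).loc i = { (E.conf u).loc i with
            busy := false
            scanA := Function.update ((E.conf u).loc i).scanA j v
            pc := .scan j .b } := by
          rw [hl]; unfold Local.receive; rw [h]
        rw [hl']
        unfold ScanInv
        dsimp only
        refine ⟨fun j' hj' => ?_, fun _ => ⟨a, u, hsa, by omega, fun w hw hw' => ?_, h, ?_⟩⟩
        · rw [Function.update_of_ne hj'.ne]
          exact FullScan.mono u.le_succ (ih1 j' hj')
        · rcases Nat.lt_or_eq_of_le hw' with h' | rfl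
          · exact ⟨_, hpc w hw (by omega)⟩
          · exact ⟨.b, by rw [hl']⟩
        · rw [Function.update_self]; exact hread
      | b =>
        obtain ⟨a₁, a₂, h1, h2, h3, h4, h5⟩ := ih2 rfl
        have hl' : (E.conf (u + 1)).loc i = { (E.conf u).loc i with
            busy := false
            scanB := Function.update ((E.conf u).loc i).scanB j v
            pc := if h : (j : ℕ) + 1 < φ then .scan ⟨(j : ℕ) + 1, h⟩ .a else .evalScan } := by
          rw [hl]; unfold Local.receive; rw [h]
        have key : ∀ j' ≤ j, ∃ a₁ a₂ b₁ b₂, FullScan E i s (u + 1) j'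
            (((E.conf u).loc i).scanA j') (Function.update ((E.conf u).loc i).scanB j v j')
            a₁ a₂ b₁ b₂ := by
          intro j' hj'
          rcases hj'.lt_or_eq with hj | rfl
          · rw [Function.update_of_ne hj.ne]
            exact FullScan.mono u.le_succ (ih1 j' hj)
          · rw [Function.update_self]
            refine ⟨a₁, a₂, a, u, h1, ?_, by omega, h3, h5, hread⟩
            by_contra hc
            have := hpc a₂ (by omega) (by omega)
            rw [h4] at this
            cases this
        rw [hl']
        unfold ScanInv
        by_cases hj : (j : ℕ) + 1 < φ
        · simp only [hj, dite_true]
          exact ⟨fun j' hj' => key j' (by simp only [Fin.lt_def, Fin.le_def] at *; omega),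
            by simp⟩
        · simp only [hj, dite_false]
          exact fun j' => key j' (by have := j'.2; simp only [Fin.le_def]; omega)
    | evalScan h hl hr hg => rw [hl] at h1; simp [PC.InARead] at h1
    | _ => simp_all [PC.InARead]

/-- All reads of a completed `ARead(φ)`, and its response. -/
lemma IsARead.scans {E : Execution n φ K} {i : Fin n} {s t : ℕ} {r : Option (Fin K)}
    (h : IsARead E i s t r) : ∃ SA SB : Fin φ → Fin K, r = scanResult SA SB ∧
      ∀ j, ∃ a₁ a₂ b₁ b₂, FullScan E i s t j (SA j) (SB j) a₁ a₂ b₁ b₂ := by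
  obtain ⟨h1, h2, h3, h4, h5⟩ := h
  have hinv := scanInv E i s h2 t h1 h3
  have h6 := h3 t h1 le_rfl
  have hm := E.move i t
  have : ((E.conf t).loc i).pc = .evalScan ∧ ((E.conf (t + 1)).loc i).y =
      scanResult ((E.conf t).loc i).scanA ((E.conf t).loc i).scanB := by
    cases hm with
    | stay hl hr hg => simp_all
    | invoke h hl hr hg => simp_all
    | scan j d v h hb he hl hr hg =>
      obtain ⟨⟨j, d, hp⟩ | hp, hx⟩ := Local.receive_scan _ v h <;> simp_all [PC.InARead]
    | _ => simp_all [PC.InARead]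
  refine ⟨_, _, h5.trans this.2, ?_⟩
  unfold ScanInv at hinv
  rw [this.1] at hinv
  exact hinv

lemma scanResult_eq_some {φ K : ℕ} {SA SB : Fin φ → Fin K} {v : Fin K}
    (h : scanResult SA SB = some v) (j : Fin φ) : SA j = v ∧ SB j = v := by
  unfold scanResult at h
  split_ifs at h with h1 h2
  simp only [Option.some.injEq] at h
  rw [← h]
  exact h2 j

/-! ### Reads overlapping fewer than `φ` writes -/

/-- The number of writes to `R_a` completed in an interval is the increase of `cnt`. -/
lemma card_storeA (E : Execution n φ K) (p : Fin n) {s t : ℕ} (hst : s ≤ t) (S : Finset ℕ)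
    (hS : ∀ u ∈ S, s ≤ u ∧ u < t ∧ (ghost E p u).cnt < (ghost E p (u + 1)).cnt) :
    S.card + (ghost E p s).cnt ≤ (ghost E p t).cnt := by
  induction t, hst using Nat.le_induction generalizing S with
  | base =>
    have : S = ∅ := Finset.eq_empty_of_forall_notMem fun u hu => by have := hS u hu; omega
    simp [this]
  | succ t hst ih =>
    have h1 := ih (S.erase t) fun u hu => by
      rw [Finset.mem_erase] at hu
      have := hS u hu.2
      exact ⟨this.1, by omega, this.2.2⟩
    have hm : _ ≤ _ := cnt_mono E p (show t ≤ t + 1 by omega)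
    dsimp only at hm
    by_cases ht : t ∈ S
    · have := hS t ht
      have := Finset.card_erase_add_one ht
      omega
    · rw [Finset.erase_eq_of_notMem ht] at h1
      omega

/-- A write in progress to `R_a` stays in progress until it is completed. -/
lemma writing_stays (E : Execution n φ K) (p : Fin n) {u w : ℕ} (huw : u ≤ w)
    (hc : (ghost E p w).cnt = (ghost E p u).cnt) (hu : ((E.conf u).loc p).pc = .store .a) :
    ((E.conf w).loc p).pc = .store .a := by
  induction w, huw using Nat.le_induction with
  | base => exact hu
  | succ w huw ih =>
    have h1 : _ ≤ _ := cnt_mono E p huw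
    have h2 : _ ≤ _ := cnt_mono E p (show w ≤ w + 1 by omega)
    dsimp only at h1 h2
    have ih := ih (by omega)
    have h3 : (ghost E p (w + 1)).cnt = (ghost E p w).cnt := by omega
    have hm := E.move p w
    cases hm <;> simp_all

/-- A scan during which no write to `R_a` is completed, and whose two reads agree, returns the
current value of the register at some point. -/
lemma FullScan.exists_curVal {E : Execution n φ K} {i : Fin n} {s t : ℕ} {j : Fin φ} {v : Fin K}
    {a₁ a₂ b₁ b₂ : ℕ} (h : FullScan E i s t j v v a₁ a₂ b₁ b₂)
    (hc : (ghost E (i - 1) (b₂ + 1)).cnt = (ghost E (i - 1) a₁).cnt) :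
    ∃ σ, s ≤ σ ∧ σ ≤ t ∧ v = curVal E (i - 1) σ := by
  obtain ⟨h1, h2, h3, -, hA, hB⟩ := h
  have ha := hA.lt
  have hb := hB.lt
  have cnt_eq : ∀ u, a₁ ≤ u → u ≤ b₂ → (ghost E (i - 1) u).cnt = (ghost E (i - 1) a₁).cnt := by
    intro u hu hu'
    have h1 : _ ≤ _ := cnt_mono E (i - 1) hu
    have h2 : _ ≤ _ := cnt_mono E (i - 1) (show u ≤ b₂ + 1 by omega)
    dsimp only at h1 h2
    omega
  -- A write overlapping the read of `R_a` cannot complete in this scan, so the writer is still at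
  -- that store when `R_b` is read: the read of `R_b` is then correct and gives the abstract value.
  -- Otherwise the read of `R_a` is correct; if `R_a` has never been written, neither has `R_b`, and
  -- the read of `R_b` gives the initial value.
  by_cases hW : ∃ u, a₁ < u ∧ u ≤ a₂ ∧ Writing (E.conf u) (i - 1, .a)
  · obtain ⟨u, hu1, hu2, hu3, -⟩ := hW
    have hst : ∀ w, u ≤ w → w ≤ b₂ → ((E.conf w).loc (i - 1)).pc = .store .a :=
      fun w hw hw' => writing_stays E _ hw
        ((cnt_eq w (by omega) hw').trans (cnt_eq u (by omega) (by omega)).symm) hu3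
    have hv := hB.eq_reg fun w hw hw' hwr => by
      have := hst w (by omega) hw'
      rw [hwr.1] at this
      cases this
    refine ⟨b₂, by omega, by omega, ?_⟩
    have hr := regInv E (i - 1) b₂
    have hpc := hst b₂ (by omega) le_rfl
    unfold curVal
    split_ifs with h0
    · rw [hv, (hr.cnt_zero h0).1]
    · rw [hv]; exact hr.cnt_pos h0 (by rw [hpc]; simp)
  · push Not at hW
    have hv := hA.eq_reg hW
    refine ⟨a₂, by omega, by omega, ?_⟩
    unfold curVal
    split_ifs with h0
    · rw [cnt_eq a₂ (by omega) (by omega)] at h0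
      have h0' : ∀ u, a₁ ≤ u → u ≤ b₂ → (ghost E (i - 1) u).cnt = 0 := fun u hu hu' =>
        (cnt_eq u hu hu').trans h0
      have hv' := hB.eq_reg fun w hw hw' hwr =>
        ((regInv E (i - 1) w).cnt_zero (h0' w (by omega) hw')).2 hwr.1
      rw [hv', ((regInv E (i - 1) b₂).cnt_zero (h0' b₂ (by omega) le_rfl)).1]
    · exact hv

/-- An `ARead(φ)` during which fewer than `φ` writes to `R_a` are completed returns `⊥` or the
current value of the register at some point. -/
lemma IsARead.exists_curVal {E : Execution n φ K} {i : Fin n} {s t : ℕ} {v : Fin K}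
    (h : IsARead E i s t (some v))
    (hc : (ghost E (i - 1) t).cnt < (ghost E (i - 1) s).cnt + φ) :
    ∃ σ, s ≤ σ ∧ σ ≤ t ∧ v = curVal E (i - 1) σ := by
  obtain ⟨SA, SB, hr, hS⟩ := h.scans
  by_contra hno
  -- If no point works, every scan contains a completed write to `R_a`. Recording the reader's
  -- control location shows that different scans contain different writes.
  have hex : ∀ j : Fin φ, ∃ u d, s ≤ u ∧ u < t ∧
      (ghost E (i - 1) u).cnt < (ghost E (i - 1) (u + 1)).cnt ∧
      ((E.conf u).loc i).pc = .scan j d := by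
    intro j
    obtain ⟨a₁, a₂, b₁, b₂, hf⟩ := hS j
    obtain ⟨hA, hB⟩ := scanResult_eq_some hr.symm j
    rw [hA, hB] at hf
    have hab : a₁ ≤ b₂ + 1 := by have := hf.readA.lt; have := hf.readB.lt; have := hf.mid; omega
    by_contra hne
    push Not at hne
    refine hno (hf.exists_curVal ?_)
    refine le_antisymm ?_ (cnt_mono E (i - 1) hab)
    have hl := hf.left
    have hri := hf.right
    have hpc := hf.pc
    have : ∀ u, a₁ ≤ u → u ≤ b₂ + 1 → (ghost E (i - 1) u).cnt ≤ (ghost E (i - 1) a₁).cnt := by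
      intro u hu
      induction u, hu using Nat.le_induction with
      | base => intro; rfl
      | succ u hu ih =>
        intro hu'
        obtain ⟨d, hd⟩ := hpc u hu (by omega)
        refine le_trans ?_ (ih (by omega))
        by_contra hlt
        exact hne u d (by omega) (by omega) (by omega) hd
    exact this _ hab le_rfl
  choose f d h1 h2 h3 h4 using hex
  have hinj : Function.Injective f := by
    intro j j' hjj
    have := h4 j
    rw [hjj, h4 j'] at this
    simp only [PC.scan.injEq] at this
    exact this.1.symm
  have := card_storeA E (i - 1) h.1.le (Finset.univ.image f) (by
    intro u hu
    obtain ⟨j, -, rfl⟩ := Finset.mem_image.mp hu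
    exact ⟨h1 j, h2 j, h3 j⟩)
  rw [Finset.card_image_of_injective _ hinj, Finset.card_univ, Fintype.card_fin] at this
  omega

/-! ### Propagation of write counts around the ring -/

/-- A copying processor agrees with `v` afterwards; processor `0` has moved away from `v`, unless `K
= 1`, where incrementing does nothing. Hence a processor reacts at most once to each version of its
predecessor's value. -/
lemma newX_newX (i : Fin n) (x v : Fin K) :
    newX i (newX i x (some v)) (some v) = newX i x (some v) := by
  unfold newX
  by_cases hi : i = 0
  · by_cases hx : v = x
    · subst hx
      by_cases hv : v = v + 1
      · simp only [hi, ne_eq, not_true_eq_false, false_and, if_false, true_and, if_true]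
        rw [if_pos hv, ← hv]; exact hv.symm
      · simp [hi, hv]
    · simp [hi, hx]
  · by_cases hx : x = v <;> simp [hi, hx]

/-- The first `c` writes to `R_a` by processor `q`, of which the last one has left the value `x`,
are accounted for by the values of the predecessor that `q` has seen between `s` and `u`. -/
def Seen (E : Execution n φ K) (q : Fin n) (s u c : ℕ) (x : Fin K) : Prop :=
  -- The first write after `s` is free, as it may stem from an arbitrary local state. In the second
  -- case, the `2` counts that write and the version already current at `s`.
  c ≤ (ghost E q s).cnt + 1 ∨ ∃ σ, s ≤ σ ∧ σ ≤ u ∧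
    c + (ghost E (q - 1) s).cnt ≤ (ghost E (q - 1) σ).cnt + (ghost E q s).cnt + 2 ∧
    newX q x (some (curVal E (q - 1) σ)) = x

lemma Seen.mono {E : Execution n φ K} {q : Fin n} {s u u' c c' : ℕ} {x : Fin K}
    (h : Seen E q s u c x) (hu : u ≤ u') (hc : c' ≤ c) : Seen E q s u' c' x := by
  rcases h with h | ⟨σ, h1, h2, h3, h4⟩
  · exact .inl (hc.trans h)
  · exact .inr ⟨σ, h1, h2.trans hu, by omega, h4⟩

/-- The value that `AWrite` is about to write is either the content of `R_a` or accounted for. -/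
def Pending (E : Execution n φ K) (q : Fin n) (s u c : ℕ) (x xa : Fin K) : Prop :=
  (x = xa ∧ Seen E q s u c x) ∨ Seen E q s u (c + 1) x

lemma Pending.mono {E : Execution n φ K} {q : Fin n} {s u u' c : ℕ} {x xa : Fin K}
    (h : Pending E q s u c x xa) (hu : u ≤ u') : Pending E q s u' c x xa :=
  h.imp (fun h => ⟨h.1, h.2.mono hu le_rfl⟩) fun h => h.mono hu le_rfl

/-- State of processor `q` after it has completed a write to `R_a` since `s`. -/
def Fresh (E : Execution n φ K) (q : Fin n) (s u c : ℕ) (l : Local φ K) (xa : Fin K) : Prop :=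
  match l.pc with
  | .readX | .retAWrite => Seen E q s u c xa
  | .callARead => l.x = xa ∧ Seen E q s u c xa
  -- `Seen` is recorded at the start `s'` of the `ARead(φ)`, so that the version it returns is not
  -- older than the one already accounted for.
  | .scan _ _ | .evalScan => l.x = xa ∧ ∃ s', s ≤ s' ∧ s' < u ∧
      ((E.conf s').loc q).pc = .callARead ∧
      (∀ w, s' < w → w ≤ u → ((E.conf w).loc q).pc.InARead) ∧ Seen E q s s' c xa
  | .guards => l.x = xa ∧ ∃ s', s ≤ s' ∧ s' ≤ u ∧ Seen E q s s' c xa ∧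
      ∀ v, l.y = some v → ∃ σ, s' ≤ σ ∧ σ ≤ u ∧ v = curVal E (q - 1) σ
  | .callAWrite => Pending E q s u c l.x xa
  | .check _ | .test => Pending E q s u c l.val xa
  | .store .a => Seen E q s u (c + 1) l.val
  | .store .b => l.val = xa ∧ Seen E q s u c xa

/-- A processor that applies the conditional statements to a value seen after those accounted for
by `Seen` has a value that is unchanged or accounted for. -/
lemma Seen.pending {E : Execution n φ K} {q : Fin n} {s s' u c σ : ℕ} {x v : Fin K}
    (h : Seen E q s s' c x) (hs : s ≤ s') (h1 : s' ≤ σ) (h2 : σ ≤ u)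
    (hv : v = curVal E (q - 1) σ) : Pending E q s u c (newX q x (some v)) x := by
  have hst : newX q (newX q x (some v)) (some (curVal E (q - 1) σ)) = newX q x (some v) := by
    rw [← hv]; exact newX_newX q x v
  have hcs : _ ≤ _ := cnt_mono E (q - 1) (hs.trans h1)
  dsimp only at hcs
  rcases h with h | ⟨σ₀, h3, h4, h5, h6⟩
  · exact .inr (.inr ⟨σ, hs.trans h1, h2, by omega, hst⟩)
  · have hc : _ ≤ _ := cnt_mono E (q - 1) (h4.trans h1)
    dsimp only at hc
    -- A newer version pays for one more write; the same version leaves `x` fixed.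
    rcases Nat.lt_or_eq_of_le hc with hlt | heq
    · exact .inr (.inr ⟨σ, hs.trans h1, h2, by omega, hst⟩)
    · have : v = curVal E (q - 1) σ₀ := hv.trans (curVal_eq E (q - 1) (h4.trans h1) heq).symm
      rw [this, h6]
      exact .inl ⟨rfl, .inr ⟨σ₀, h3, by omega, h5, h6⟩⟩

lemma Fresh.stay {E : Execution n φ K} {q : Fin n} {s u c : ℕ} {l l' : Local φ K} {xa : Fin K}
    (h : Fresh E q s u c l xa) (hp : l'.pc = l.pc) (hx : l'.x = l.x) (hy : l'.y = l.y)
    (hv : l'.val = l.val) (hl : (E.conf (u + 1)).loc q = l') :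
    Fresh E q s (u + 1) c l' xa := by
  unfold Fresh at h ⊢
  rw [hp, hx, hy, hv]
  have hin : l.pc.InARead → ∀ s', (∀ w, s' < w → w ≤ u → ((E.conf w).loc q).pc.InARead) →
      ∀ w, s' < w → w ≤ u + 1 → ((E.conf w).loc q).pc.InARead := by
    intro hi s' hs' w hw hw'
    rcases Nat.lt_or_eq_of_le hw' with h' | rfl
    · exact hs' w hw (by omega)
    · rw [hl, hp]; exact hi
  cases hpc : l.pc with
  | readX => rw [hpc] at h; exact h.mono u.le_succ le_rfl
  | callARead => rw [hpc] at h; exact ⟨h.1, h.2.mono u.le_succ le_rfl⟩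
  | scan j d =>
    rw [hpc] at h
    obtain ⟨h1, s', h2, h3, h4, h5, h6⟩ := h
    exact ⟨h1, s', h2, by omega, h4, hin (by rw [hpc]; trivial) s' h5, h6⟩
  | evalScan =>
    rw [hpc] at h
    obtain ⟨h1, s', h2, h3, h4, h5, h6⟩ := h
    exact ⟨h1, s', h2, by omega, h4, hin (by rw [hpc]; trivial) s' h5, h6⟩
  | guards =>
    rw [hpc] at h
    obtain ⟨h1, s', h2, h3, h4, h5⟩ := h
    refine ⟨h1, s', h2, by omega, h4, fun v hv => ?_⟩
    obtain ⟨σ, h6, h7, h8⟩ := h5 v hv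
    exact ⟨σ, h6, by omega, h8⟩
  | callAWrite => rw [hpc] at h; exact h.mono u.le_succ
  | check d => rw [hpc] at h; exact h.mono u.le_succ
  | test => rw [hpc] at h; exact h.mono u.le_succ
  | store d =>
    rw [hpc] at h
    cases d with
    | a => exact h.mono u.le_succ le_rfl
    | b => exact ⟨h.1, h.2.mono u.le_succ le_rfl⟩
  | retAWrite => rw [hpc] at h; exact h.mono u.le_succ le_rfl

/-- The bound on the predecessor's writes is needed at the end of an `ARead(φ)`: it makes the
response an abstract value of the predecessor, which is what `Seen.pending` requires. -/
lemma fresh_succ {E : Execution n φ K} {q : Fin n} {s u : ℕ} (hsu : s ≤ u)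
    (hφ : (ghost E (q - 1) u).cnt < (ghost E (q - 1) s).cnt + φ)
    (h : (ghost E q u).cnt = (ghost E q s).cnt ∨ ((ghost E q s).cnt < (ghost E q u).cnt ∧
      Fresh E q s u (ghost E q u).cnt ((E.conf u).loc q) ((E.conf u).reg q .a))) :
    (ghost E q (u + 1)).cnt = (ghost E q s).cnt ∨ ((ghost E q s).cnt < (ghost E q (u + 1)).cnt ∧
      Fresh E q s (u + 1) (ghost E q (u + 1)).cnt ((E.conf (u + 1)).loc q)
        ((E.conf (u + 1)).reg q .a)) := by
  have hm := E.move q u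
  rcases h with h | ⟨hc, hF⟩
  · cases hm with
    | storeA hp hl hr hg =>
      right
      rw [hl, hr, hg, h]
      exact ⟨by simp, by simp [Fresh, Seen]⟩
    | _ => left; simp_all
  · right
    have hF0 := hF
    unfold Fresh at hF
    have hri := regInv E q u
    have enter : ∀ s', ((E.conf (u + 1)).loc q).pc.InARead →
        (∀ w, s' < w → w ≤ u → ((E.conf w).loc q).pc.InARead) →
        ∀ w, s' < w → w ≤ u + 1 → ((E.conf w).loc q).pc.InARead := by
      intro s' hi hs' w hw hw'
      rcases Nat.lt_or_eq_of_le hw' with h' | rfl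
      · exact hs' w hw (by omega)
      · exact hi
    cases hm with
    | stay hl hr hg =>
      rw [hg, hr]
      exact ⟨hc, hF0.stay (by rw [hl]) (by rw [hl]) (by rw [hl]) (by rw [hl]) rfl⟩
    | invoke h hl hr hg =>
      rw [hg, hr]
      exact ⟨hc, hF0.stay (by rw [hl]) (by rw [hl]) (by rw [hl]) (by rw [hl]) rfl⟩
    | readX h hl hr hg =>
      rw [h] at hF
      rw [hl, hr, hg]
      exact ⟨hc, rfl, hF.mono u.le_succ le_rfl⟩
    | callARead h hl hr hg =>
      rw [h] at hF
      rw [hg, hr]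
      refine ⟨hc, ?_⟩
      have hx : ((E.conf (u + 1)).loc q).x = (E.conf u).reg q .a := by rw [hl]; exact hF.1
      have hi : ((E.conf (u + 1)).loc q).pc.InARead := by
        rcases PC.callARead_next (φ := φ) with ⟨j, d, hp⟩ | hp <;> rw [hl, hp] <;> trivial
      have key : ((E.conf (u + 1)).loc q).x = (E.conf u).reg q .a ∧ ∃ s', s ≤ s' ∧ s' < u + 1 ∧
          ((E.conf s').loc q).pc = .callARead ∧
          (∀ w, s' < w → w ≤ u + 1 → ((E.conf w).loc q).pc.InARead) ∧
          Seen E q s s' (ghost E q u).cnt ((E.conf u).reg q .a) :=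
        ⟨hx, u, hsu, by omega, h, enter u hi fun w hw hw' => by omega, hF.2⟩
      unfold Fresh
      rcases PC.callARead_next (φ := φ) with ⟨j, d, hp⟩ | hp <;> rw [hp] at hl <;>
      · rw [show ((E.conf (u + 1)).loc q).pc = _ from by rw [hl]]
        exact key
    | scan j d v h hb he hl hr hg =>
      rw [h] at hF
      rw [hg, hr]
      refine ⟨hc, ?_⟩
      obtain ⟨h1, s', h2, h3, h4, h5, h6⟩ := hF
      obtain ⟨hpc, hx⟩ := Local.receive_scan _ v h
      rw [← hl] at hpc hx
      unfold Fresh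
      rcases hpc with ⟨j', d', hp⟩ | hp <;>
      · have hi : ((E.conf (u + 1)).loc q).pc.InARead := by rw [hp]; trivial
        rw [hp]
        exact ⟨hx.trans h1, s', h2, by omega, h4, enter s' hi h5, h6⟩
    | evalScan h hl hr hg =>
      rw [h] at hF
      obtain ⟨h1, s', h2, h3, h4, h5, h6⟩ := hF
      have hread : IsARead E q s' u ((E.conf (u + 1)).loc q).y :=
        ⟨h3, h4, h5, by rw [hl]; exact id, rfl⟩
      have hcs : _ ≤ _ := cnt_mono E (q - 1) h2
      dsimp only at hcs
      have hval : ∀ v, ((E.conf (u + 1)).loc q).y = some v →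
          ∃ σ, s' ≤ σ ∧ σ ≤ u + 1 ∧ v = curVal E (q - 1) σ := by
        intro v hv
        rw [hv] at hread
        obtain ⟨σ, h7, h8, h9⟩ := hread.exists_curVal (by omega)
        exact ⟨σ, h7, by omega, h9⟩
      rw [hl] at hval
      rw [hl, hr, hg]
      exact ⟨hc, h1, s', h2, by omega, h6, hval⟩
    | guards h hl hr hg =>
      rw [h] at hF
      rw [hl, hr, hg]
      refine ⟨hc, ?_⟩
      obtain ⟨h1, s', h2, h3, h4, h5⟩ := hF
      unfold Fresh
      dsimp only
      cases hy : ((E.conf u).loc q).y with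
      | none =>
        rw [h1]
        exact .inl ⟨rfl, h4.mono (by omega) le_rfl⟩
      | some v =>
        obtain ⟨σ, h6, h7, h8⟩ := h5 v hy
        rw [h1]
        exact h4.pending h2 h6 (by omega) h8
    | callAWrite h hl hr hg =>
      rw [h] at hF
      rw [hl, hr, hg]
      exact ⟨hc, hF.mono u.le_succ⟩
    | checkA h hl hr hg =>
      rw [h] at hF
      rw [hl, hr, hg]
      exact ⟨hc, hF.mono u.le_succ⟩
    | checkB h hl hr hg =>
      rw [h] at hF
      rw [hl, hr, hg]
      exact ⟨hc, hF.mono u.le_succ⟩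
    | skip h hA hB hl hr hg =>
      rw [h] at hF
      have hval : ((E.conf u).loc q).val = (E.conf u).reg q .a := by
        rw [← hA]; exact (hri.test h).1
      rw [hl, hr, hg]
      refine ⟨hc, ?_⟩
      unfold Fresh
      dsimp only at hF ⊢
      rw [hval] at hF
      rcases hF with hF | hF
      · exact hF.2.mono u.le_succ le_rfl
      · exact hF.mono u.le_succ (Nat.le_succ _)
    | change h hv hl hr hg =>
      rw [h] at hF
      rw [hl, hr, hg]
      refine ⟨hc, ?_⟩
      rcases hF with hF | hF
      -- A value equal to the content of `R_a` would have passed the test, as both registers agree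
      -- after the first write. So only accounted values are stored.
      · obtain ⟨hA, hB⟩ := hri.test h
        have := hri.cnt_pos (by omega) (by rw [h]; simp)
        exact absurd ⟨hA.trans hF.1.symm, (hB.trans this).trans hF.1.symm⟩ hv
      · exact hF.mono u.le_succ le_rfl
    | storeA h hl hr hg =>
      rw [h] at hF
      rw [hl, hr, hg, Function.update_self]
      exact ⟨by dsimp only; omega, rfl, hF.mono u.le_succ le_rfl⟩
    | storeB h hl hr hg =>
      rw [h] at hF
      rw [hl, hr, hg, Function.update_of_ne (by simp)]
      exact ⟨hc, hF.2.mono u.le_succ le_rfl⟩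
    | ret h hl hr hg =>
      rw [h] at hF
      rw [hl, hr, hg]
      exact ⟨hc, hF.mono u.le_succ le_rfl⟩

/-- Every control location carries a form of `Seen` for at least `c` writes, at a time not after
`u`; monotonicity of the predecessor's `cnt` does the rest. -/
lemma Fresh.le {E : Execution n φ K} {q : Fin n} {s u c : ℕ} {l : Local φ K} {xa : Fin K}
    (h : Fresh E q s u c l xa) (hsu : s ≤ u) :
    c + (ghost E (q - 1) s).cnt ≤ (ghost E (q - 1) u).cnt + (ghost E q s).cnt + 2 := by
  have key : ∀ u' ≤ u, ∀ x, Seen E q s u' c x →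
      c + (ghost E (q - 1) s).cnt ≤ (ghost E (q - 1) u).cnt + (ghost E q s).cnt + 2 := by
    rintro u' hu' x (h | ⟨σ, h1, h2, h3, h4⟩)
    · have hcs : _ ≤ _ := cnt_mono E (q - 1) hsu
      dsimp only at hcs
      omega
    · have hcs : _ ≤ _ := cnt_mono E (q - 1) (h2.trans hu')
      dsimp only at hcs
      omega
  have key' : ∀ x, Pending E q s u c x xa →
      c + (ghost E (q - 1) s).cnt ≤ (ghost E (q - 1) u).cnt + (ghost E q s).cnt + 2 := by
    rintro x (⟨-, h⟩ | h)
    · exact key u le_rfl x h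
    · exact key u le_rfl x (h.mono le_rfl (Nat.le_succ c))
  unfold Fresh at h
  split at h
  · exact key u le_rfl _ h
  · exact key u le_rfl _ h
  · exact key u le_rfl _ h.2
  · obtain ⟨-, s', -, h3, -, -, h6⟩ := h; exact key s' h3.le _ h6
  · obtain ⟨-, s', -, h3, -, -, h6⟩ := h; exact key s' h3.le _ h6
  · obtain ⟨-, s', -, h3, h4, -⟩ := h; exact key s' h3 _ h4
  · exact key' _ h
  · exact key' _ h
  · exact key' _ h
  · exact key u le_rfl _ (h.mono le_rfl (Nat.le_succ c))
  · exact key u le_rfl _ h.2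

/-- If a processor writes to `R_a` at most `m < φ` times in an interval, then its successor does so
at most `m + 2` times. -/
lemma cnt_succ_le (E : Execution n φ K) (q : Fin n) {s t m : ℕ} (hm : m < φ)
    (h : ∀ u, s ≤ u → u ≤ t → (ghost E (q - 1) u).cnt ≤ (ghost E (q - 1) s).cnt + m)
    (u : ℕ) (hsu : s ≤ u) (hut : u ≤ t) : (ghost E q u).cnt ≤ (ghost E q s).cnt + (m + 2) := by
  have inv : (ghost E q u).cnt = (ghost E q s).cnt ∨ ((ghost E q s).cnt < (ghost E q u).cnt ∧
      Fresh E q s u (ghost E q u).cnt ((E.conf u).loc q) ((E.conf u).reg q .a)) := by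
    induction u, hsu using Nat.le_induction with
    | base => exact .inl rfl
    | succ u hsu ih =>
      have := h u hsu (by omega)
      exact fresh_succ hsu (by omega) (ih (by omega))
  have := h u hsu hut
  rcases inv with h | ⟨-, hF⟩
  · omega
  · have := hF.le hsu
    omega

/-- A processor writes no register during its `ARead(φ)`. -/
lemma IsARead.cnt_eq {E : Execution n φ K} {i : Fin n} {s t : ℕ} {r : Option (Fin K)}
    (h : IsARead E i s t r) (u : ℕ) (hsu : s ≤ u) (hut : u ≤ t) :
    (ghost E i u).cnt = (ghost E i s).cnt := by
  induction u, hsu using Nat.le_induction with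
  | base => rfl
  | succ u hsu ih =>
    rw [← ih (by omega)]
    have hpc : ((E.conf u).loc i).pc ≠ .store .a := by
      rcases Nat.lt_or_eq_of_le hsu with h' | rfl
      · have := h.2.2.1 u h' (by omega)
        intro hc
        rw [hc] at this
        exact this
      · rw [h.2.1]; simp
    have hm := E.move i u
    cases hm <;> simp_all

/-- The predecessor completes fewer than `φ` writes to `R_a` during an `ARead(φ)`. -/
lemma IsARead.cnt_lt (hφ : 2 * n < φ) {E : Execution n φ K} {i : Fin n} {s t : ℕ}
    {r : Option (Fin K)} (h : IsARead E i s t r) :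
    (ghost E (i - 1) t).cnt < (ghost E (i - 1) s).cnt + φ := by
  -- Induction along the ring starting at the reader, whose own count is constant; each successor
  -- adds `2`. The predecessor is reached at `k = n - 1`.
  have key : ∀ k < n, ∀ u, s ≤ u → u ≤ t →
      (ghost E (i + k • 1) u).cnt ≤ (ghost E (i + k • 1) s).cnt + 2 * k := by
    intro k hk
    induction k with
    | zero =>
      intro u h1 h2
      simp [h.cnt_eq u h1 h2]
    | succ k ih =>
      refine cnt_succ_le E _ (m := 2 * k) (by omega) ?_
      have : i + (k + 1) • (1 : Fin n) - 1 = i + k • 1 := by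
        rw [succ_nsmul, ← add_assoc, add_sub_cancel_right]
      rw [this]
      exact ih (by omega)
  have hn : 0 < n := Nat.pos_of_ne_zero (NeZero.ne n)
  have hlast : i + (n - 1) • (1 : Fin n) = i - 1 := by
    rw [eq_sub_iff_add_eq, add_assoc, ← succ_nsmul, Nat.sub_add_cancel hn]
    have := card_nsmul_eq_zero' (x := (1 : Fin n))
    rw [Nat.card_eq_fintype_card, Fintype.card_fin] at this
    rw [this, add_zero]
  have := key (n - 1) (by omega) t h.1.le le_rfl
  rw [hlast] at this
  omega

/-! ### Responses `⊥` and quasi-atomicity -/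

lemma IsARead.end_unique {E : Execution n φ K} {i : Fin n} {s t t' : ℕ} {r r' : Option (Fin K)}
    (h : IsARead E i s t r) (h' : IsARead E i s t' r') : t = t' := by
  obtain ⟨h1, -, h2, h3, -⟩ := h
  obtain ⟨h1', -, h2', h3', -⟩ := h'
  rcases lt_trichotomy t t' with hlt | heq | hlt
  · exact absurd (h2' (t + 1) (by omega) hlt) h3
  · exact heq
  · exact absurd (h2 (t' + 1) (by omega) hlt) h3'

/-- Registers do not change while their writer is outside `AWrite`. -/
lemma reg_eq (E : Execution n φ K) (p : Fin n) {s t : ℕ}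
    (h : ∀ w, s < w → w ≤ t → ¬ ((E.conf w).loc p).pc.InAWrite) (u : ℕ) (hsu : s < u)
    (hut : u ≤ t) : (E.conf u).reg p = (E.conf (s + 1)).reg p := by
  induction u, hsu using Nat.le_induction with
  | base => rfl
  | succ u hsu ih =>
    rw [← ih (by omega)]
    have hp := h u hsu (by omega)
    have hm := E.move p u
    cases hm <;> simp_all [PC.InAWrite]

/-- An `ARead(φ)` that is not concurrent with an `AWrite`, and that finds equal contents in the two
registers, returns a value. -/
lemma IsARead.ne_none (hφ : 0 < φ) {E : Execution n φ K} {i : Fin n} {s t : ℕ}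
    {r : Option (Fin K)} (h : IsARead E i s t r)
    (hq : ∀ w, s < w → w ≤ t → ¬ ((E.conf w).loc (i - 1)).pc.InAWrite)
    (hr : (E.conf (s + 1)).reg (i - 1) .b = (E.conf (s + 1)).reg (i - 1) .a) : r ≠ none := by
  obtain ⟨SA, SB, rfl, hS⟩ := h.scans
  have key : ∀ j, SA j = (E.conf (s + 1)).reg (i - 1) .a ∧
      SB j = (E.conf (s + 1)).reg (i - 1) .a := by
    intro j
    obtain ⟨a₁, a₂, b₁, b₂, hf⟩ := hS j
    have ha := hf.readA.lt
    have hb := hf.readB.lt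
    have h1 := hf.left
    have h2 := hf.mid
    have h3 := hf.right
    have hw : ∀ w d, s < w → w ≤ t → ¬ Writing (E.conf w) (i - 1, d) := by
      intro w d hw hw' hW
      refine hq w hw hw' ?_
      rw [hW.1]; trivial
    constructor
    · rw [hf.readA.eq_reg fun w h4 h5 => hw w _ (by omega) (by omega)]
      rw [reg_eq E _ hq a₂ (by omega) (by omega)]
    · rw [hf.readB.eq_reg fun w h4 h5 => hw w _ (by omega) (by omega)]
      rw [reg_eq E _ hq b₂ (by omega) (by omega), hr]
  unfold scanResult
  rw [dif_pos hφ, if_pos]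
  · simp
  · exact fun j => ⟨(key j).1.trans (key _).1.symm, (key j).2.trans (key _).1.symm⟩

/-- A response `⊥` has one of the two legitimate reasons. -/
lemma IsARead.none_cases (hφ : 0 < φ) {E : Execution n φ K} {i : Fin n} {s t : ℕ}
    (h : IsARead E i s t none) :
    (∃ w v, InvokesAWrite E (i - 1) w v ∧ w < t ∧ ∀ t', IsAWrite E (i - 1) w t' → s < t') ∨
      ((E.conf 0).reg (i - 1) .a ≠ (E.conf 0).reg (i - 1) .b ∧
        ∀ w t', IsAWrite E (i - 1) w t' → ¬ t' < s) := by
  by_contra hcon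
  push Not at hcon
  obtain ⟨hno, hinit⟩ := hcon
  -- An `AWrite` active in this interval would be invoked before `t`, hence return by an event not
  -- after `s`, although control is still inside it later.
  have hq : ∀ w, s < w → w ≤ t → ¬ ((E.conf w).loc (i - 1)).pc.InAWrite := by
    intro u hu hu' hin
    obtain ⟨h1, h2, h3⟩ := inAWrite_inv E (i - 1) u hin
    obtain ⟨t', h4, h5⟩ := hno _ _ h2 (by omega)
    exact h4.2.2.2 (h3 (t' + 1) (by have := h4.1; omega) (by omega))
  have hpc : ((E.conf (s + 1)).loc (i - 1)).pc ≠ .store .b := by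
    intro hc
    refine hq (s + 1) (by omega) h.1 ?_
    rw [hc]; trivial
  have hri := regInv E (i - 1) (s + 1)
  refine h.ne_none hφ hq ?_ rfl
  by_cases h0 : (ghost E (i - 1) (s + 1)).own = ⊥
  · by_cases hab : (E.conf 0).reg (i - 1) .a = (E.conf 0).reg (i - 1) .b
    · rw [(hri.cnt_zero (hri.own_bot h0)).1, hab]
    -- With different initial contents some `AWrite` has been completed before `s`, so `own` cannot
    -- be `⊥`.
    · obtain ⟨w, t', h1, h2⟩ := hinit hab
      have := h1.le_own (show t' < s + 1 by omega)
      rw [h0] at this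
      simp at this
  · exact hri.own_ne h0 hpc

lemma quasiAtomic (hφ : 2 * n < φ) (E : Execution n φ K) (i : Fin n) : QuasiAtomic E i := by
  classical
  -- The start `s` determines the end and the response, so `σ` can depend on `s` alone, as `src`
  -- does; `0` is a dummy where no such `ARead(φ)` starts.
  have hex : ∀ s, ∃ σ, ∀ t v, IsARead E i s t (some v) →
      s ≤ σ ∧ σ ≤ t ∧ v = curVal E (i - 1) σ := by
    intro s
    by_cases h : ∃ t v, IsARead E i s t (some v)
    · obtain ⟨t, v, h⟩ := h
      obtain ⟨σ, h1⟩ := h.exists_curVal (h.cnt_lt hφ)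
      refine ⟨σ, fun t' v' h' => ?_⟩
      obtain rfl := h.end_unique h'
      have := h.2.2.2.2.trans h'.2.2.2.2.symm
      obtain rfl := Option.some.inj this
      exact h1
    · push Not at h
      exact ⟨0, fun t v h' => absurd h' (h t v)⟩
  choose σ hσ using hex
  refine ⟨(E.conf 0).reg (i - 1) .b, fun s => (ghost E (i - 1) (σ s)).own, .inr rfl, ?_, ?_, ?_,
    fun s t h => h.none_cases (by omega)⟩
  · intro s t v h
    obtain ⟨h1, h2, h3⟩ := hσ s t v h
    rw [h3]
    rcases curVal_own E (i - 1) (σ s) with h | ⟨w, h4, h5, h6⟩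
    · exact .inl h
    · exact .inr ⟨w, h4, h5, by omega⟩
  · intro s t v h w t' hw hlt ht'
    obtain ⟨h1, h2, h3⟩ := hσ s t v h
    -- An `AWrite` completed before the `ARead(φ)` is effective at `σ s`, so it is not later than
    -- the source.
    exact absurd (hw.le_own (show t' < σ s by omega)) (not_le_of_gt hlt)
  · intro s₁ t₁ v₁ s₂ t₂ v₂ h₁ h₂ hlt
    have h1 := hσ s₁ t₁ v₁ h₁
    have h2 := hσ s₂ t₂ v₂ h₂
    exact own_mono E (i - 1) (show σ s₁ ≤ σ s₂ by omega)

end TwoRegRing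

theorem mainTheorem7 (n φ K : ℕ) [NeZero n] [NeZero K] (hφ : 2 * n < φ)
    (E : TwoRegRing.Execution n φ K) (i : Fin n) : TwoRegRing.QuasiAtomic E i :=
  TwoRegRing.quasiAtomic hφ E i
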